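/- Let $n\ge 0$ be an integer. For integers $A,a\ge 1$ and a partition $\pi$ of $n$, let $\operatorname{mex}_{A,a}(\pi)$ be the smallest integer $\ge a$ that is congruent to $a$ modulo $A$ and is not a part of $\pi$, and let $\overline{p}_{A,a}(n)$ be the number of partitions $\pi$ of $n$ with $\operatorname{mex}_{A,a}(\pi)\equiv A+a \pmod{2A}$. The rank of a partition is its largest part minus its number of parts. The crank of a partition is its largest part if $1$ is not a part, and otherwise it is the number of parts larger than $\omega$, minus $\omega$, where $\omega$ is the number of ones among the parts (the empty partition has rank and crank $0$). Let $N(m,n)$ be the number of partitions of $n$ with rank $m$. For $n\neq 1$ let $M(m,n)$ be the number of partitions of $n$ with crank $m$; for $n=1$ put, as usual, $M(0,1)=-1$, $M(1,1)=M(-1,1)=1$ and $M(m,1)=0$ for $|m|\geq 2$. Let $N_2(n)=\sum_{m\in\mathbb{Z}}m^2N(m,n)$ and $M_2(n)=\sum_{m\in\mathbb{Z}}m^2M(m,n)$ be the second rank moment and the second crank moment. Then, for every integer $n\ge 0$ (empty sums being $0$), $$N_2(n)=2\sum_{r=0}^{n-2}(2r+1)\,\overline{p}_{3,r+2}(n)\qquad\text{and}\qquad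 M_2(n)=2\sum_{r=0}^{n-1}(2r+1)\,\overline{p}_{1,r+1}(n).$$ -/

import Mathlib

namespace MexPartition

/-- `mex A a π`: the smallest integer that is at least `a`, congruent to `a` modulo `A`, and not a
part of `π`. (For `A ≥ 1` such integers exist, see `mex_spec`.) -/
noncomputable def mex (A a : ℕ) {n : ℕ} (π : n.Partition) : ℕ :=
  sInf {m : ℕ | a ≤ m ∧ m ≡ a [MOD A] ∧ m ∉ π.parts}

theorem mex_spec {A : ℕ} (hA : 0 < A) (a : ℕ) {n : ℕ} (π : n.Partition) :
    a ≤ mex A a π ∧ mex A a π ≡ a [MOD A] ∧ mex A a π ∉ π.parts := by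
  have hne : {m : ℕ | a ≤ m ∧ m ≡ a [MOD A] ∧ m ∉ π.parts}.Nonempty := by
    refine ⟨a + A * (n + 1), by omega, by simp [Nat.ModEq], fun h => ?_⟩
    have h1 := Nat.Partition.le_of_mem_parts h
    have h2 : n + 1 ≤ A * (n + 1) := Nat.le_mul_of_pos_left _ hA
    omega
  exact Nat.sInf_mem hne

/-- `pBar A a n`: the number of partitions `π` of `n` with `mex A a π ≡ A + a (mod 2A)`. -/
noncomputable def pBar (A a n : ℕ) : ℕ :=
  (Finset.univ.filter fun π : n.Partition => mex A a π ≡ A + a [MOD 2 * A]).card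

/-- The largest part of a partition (`0` for the empty partition). -/
def largestPart {n : ℕ} (π : n.Partition) : ℕ := π.parts.sup

/-- The rank: the largest part minus the number of parts. -/
def rank {n : ℕ} (π : n.Partition) : ℤ := (largestPart π : ℤ) - (π.parts.card : ℤ)

/-- The crank: the largest part if there are no ones, and otherwise the number of parts larger than
the number of ones, minus the number of ones. -/
def crank {n : ℕ} (π : n.Partition) : ℤ :=
  if π.parts.count 1 = 0 then (largestPart π : ℤ)
  else ((π.parts.filter fun i => π.parts.count 1 < i).card : ℤ) - (π.parts.count 1 : ℤ)

/-- `N(m, n)`: the number of partitions of `n` with rank `m`. -/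
def rankNumber (m : ℤ) (n : ℕ) : ℤ :=
  ((Finset.univ.filter fun π : n.Partition => rank π = m).card : ℤ)

/-- `M(m, n)`: the number of partitions of `n` with crank `m`, with the universal convention
`M(0, 1) = -1`, `M(1, 1) = M(-1, 1) = 1` (and `M(m, 1) = 0` otherwise) for the single exceptional
value `n = 1`, where Garvan's generating function
`∑ M(m, n) q ^ n = (1 / (q)_∞) ∑_{k ≥ 1} (-1) ^ (k - 1) q ^ (k (k - 1) / 2 + k |m|) (1 - q ^ k)`
does not count partitions by their crank. -/
def crankNumber (m : ℤ) (n : ℕ) : ℤ :=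
  if n = 1 then
    if m = 0 then -1 else if m = 1 ∨ m = -1 then 1 else 0
  else ((Finset.univ.filter fun π : n.Partition => crank π = m).card : ℤ)

/-- The `k`-th rank moment `∑_{m ∈ ℤ} m ^ k N(m, n)`, a sum with finitely many nonzero terms
(see `rankNumber_support_finite`). -/
noncomputable def rankMoment (k n : ℕ) : ℤ := ∑ᶠ m : ℤ, m ^ k * rankNumber m n

/-- The `k`-th crank moment `∑_{m ∈ ℤ} m ^ k M(m, n)`, a sum with finitely many nonzero terms
(see `crankNumber_support_finite`). -/
noncomputable def crankMoment (k n : ℕ) : ℤ := ∑ᶠ m : ℤ, m ^ k * crankNumber m n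

theorem rankNumber_support_finite (n : ℕ) : {m : ℤ | rankNumber m n ≠ 0}.Finite := by
  refine (Set.finite_range fun π : n.Partition => rank π).subset fun m hm => ?_
  by_contra h
  apply hm
  simp only [Set.mem_range, not_exists] at h
  simp [rankNumber, h]

theorem crankNumber_support_finite (n : ℕ) : {m : ℤ | crankNumber m n ≠ 0}.Finite := by
  by_cases hn : n = 1
  · refine (Set.toFinite ({0, 1, -1} : Set ℤ)).subset fun m hm => ?_
    by_contra h
    apply hm
    simp only [Set.mem_insert_iff, Set.mem_singleton_iff, not_or] at h
    simp [crankNumber, hn, h]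
  · refine (Set.finite_range fun π : n.Partition => crank π).subset fun m hm => ?_
    by_contra h
    apply hm
    simp only [Set.mem_range, not_exists] at h
    simp [crankNumber, hn, h]

end MexPartition

/-! Since `k ^ 2` is the sum of the first `|k|` odd numbers, a second moment is the sum over `r` of
`2r + 1` times the number of partitions with statistic at least `r + 1` or at most `-(r + 1)`. So it
suffices that each rank tail is counted by `pBar 3 (r + 2)` and, for `n ≥ 2`, each crank tail by
`pBar 1 (r + 1)`; `n = 0` and `n = 1` are checked directly for the crank.

Removing one copy of `a` gives `pBar A a (n + a) + pBar A (a + A) n = p(n)`. Together with vanishing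
for `n < a` this determines `pBar` (`eq_pBar_of_recursion`), so each tail only has to satisfy the
same recursion.

For the rank, the recursion is Dyson's map: removing the largest part on one side and the first
column on the other leaves the same partitions (`cnt_rank_upper`, `cnt_rank_lower`).

For the crank, sorting by the number of ones turns the tails into `lowerSum` and `upperSum`. Their
terms have two readings, by inserting a part (`sub_gt_eq_cnt`) or a part of the conjugate
(`sub_gt_eq_cnt_gt`). Under these, the recursion says that the decreasing sequence `gt s` either
meets or jumps over a shifted diagonal, exactly once (`sum_meet_add_jump`). -/

namespace MexPartition

open Finset

/-! ### Partitions as decreasing sequences: `gt s` is the conjugate partition -/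

/-- The number of elements of `s` larger than `t`. -/
def gt (s : Multiset ℕ) (t : ℕ) : ℕ := s.countP (t < ·)

@[simp] theorem gt_zero (t : ℕ) : gt 0 t = 0 := by simp [gt]

theorem gt_add (s u : Multiset ℕ) (t : ℕ) : gt (s + u) t = gt s t + gt u t :=
  Multiset.countP_add _ _ _

theorem gt_cons (a : ℕ) (s : Multiset ℕ) (t : ℕ) :
    gt (a ::ₘ s) t = gt s t + if t < a then 1 else 0 :=
  Multiset.countP_cons _ _ _

theorem gt_replicate (k a t : ℕ) : gt (Multiset.replicate k a) t = if t < a then k else 0 := by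
  induction k with
  | zero => simp
  | succ k ih => rw [Multiset.replicate_succ, gt_cons, ih]; split_ifs <;> rfl

theorem gt_antitone (s : Multiset ℕ) : Antitone (gt s) := by
  intro a b h
  induction s using Multiset.induction with
  | empty => simp
  | cons c s ih => rw [gt_cons, gt_cons]; split_ifs <;> omega

theorem gt_eq_gt_succ_add_count (s : Multiset ℕ) (v : ℕ) :
    gt s v = gt s (v + 1) + s.count (v + 1) := by
  induction s using Multiset.induction with
  | empty => simp
  | cons c s ih => rw [gt_cons, gt_cons, Multiset.count_cons, ih]; split_ifs <;> omega

theorem gt_le_sum (s : Multiset ℕ) (t : ℕ) : gt s t ≤ s.sum := by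
  induction s using Multiset.induction with
  | empty => simp
  | cons c s ih => rw [gt_cons, Multiset.sum_cons]; split_ifs <;> omega

theorem gt_eq_zero_iff (s : Multiset ℕ) (t : ℕ) : gt s t = 0 ↔ ∀ a ∈ s, a ≤ t := by
  simp [gt, Multiset.countP_eq_zero]

theorem gt_eq_zero_of_sum_le {s : Multiset ℕ} {t : ℕ} (h : s.sum ≤ t) : gt s t = 0 :=
  (gt_eq_zero_iff s t).2 fun _ ha => (Multiset.le_sum_of_mem ha).trans h

theorem card_eq_gt_zero {s : Multiset ℕ} (h : ∀ a ∈ s, 0 < a) : s.card = gt s 0 :=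
  (Multiset.countP_eq_card.2 h).symm

theorem sum_eq_sum_gt {s : Multiset ℕ} {N : ℕ} (h : gt s N = 0) :
    s.sum = ∑ i ∈ range N, gt s i := by
  rw [gt_eq_zero_iff] at h
  induction s using Multiset.induction with
  | empty => simp
  | cons c s ih =>
    have hc : ∑ i ∈ range N, (if i < c then 1 else 0) = c := by
      rw [← card_filter]
      have : filter (fun i => i < c) (range N) = range c := by
        ext i
        have := h c (Multiset.mem_cons_self _ _)
        simp only [mem_filter, mem_range]
        omega
      rw [this, card_range]
    simp only [gt_cons, sum_add_distrib, hc, Multiset.sum_cons]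
    rw [ih fun a ha => h a (Multiset.mem_cons_of_mem ha), add_comm]

theorem ext_gt {s u : Multiset ℕ} (hs : ∀ a ∈ s, 0 < a) (hu : ∀ a ∈ u, 0 < a)
    (h : gt s = gt u) : s = u := by
  ext v
  rcases v with _ | v
  · rw [Multiset.count_eq_zero_of_notMem fun h0 => absurd (hs 0 h0) (lt_irrefl _),
      Multiset.count_eq_zero_of_notMem fun h0 => absurd (hu 0 h0) (lt_irrefl _)]
  · have h1 := gt_eq_gt_succ_add_count s v
    have h2 := gt_eq_gt_succ_add_count u v
    rw [h] at h1
    omega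

/-- The multiset of positive integers below `N + 1` with `f (v - 1) - f v` copies of `v`. -/
def ofSeq (f : ℕ → ℕ) (N : ℕ) : Multiset ℕ :=
  ∑ i ∈ range N, Multiset.replicate (f i - f (i + 1)) (i + 1)

theorem pos_of_mem_ofSeq {f : ℕ → ℕ} {N a : ℕ} (h : a ∈ ofSeq f N) : 0 < a := by
  rw [ofSeq, Multiset.mem_sum] at h
  obtain ⟨i, -, hi⟩ := h
  rw [Multiset.eq_of_mem_replicate hi]
  omega

theorem gt_ofSeq {f : ℕ → ℕ} (hf : Antitone f) {N : ℕ} (hN : f N = 0) : gt (ofSeq f N) = f := by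
  have key : ∀ M t, t ≤ M → gt (ofSeq f M) t = f t - f M := by
    intro M
    induction M with
    | zero => intro t ht; obtain rfl : t = 0 := by omega
              simp [ofSeq]
    | succ M ih =>
      intro t ht
      rw [ofSeq, sum_range_succ, gt_add, gt_replicate, ← ofSeq]
      rcases Nat.lt_or_ge M t with h | h
      · obtain rfl : t = M + 1 := by omega
        have : gt (ofSeq f M) (M + 1) = 0 := by
          have h1 := gt_antitone (ofSeq f M) (Nat.le_succ M)
          have h2 := ih M le_rfl
          simp only [Nat.succ_eq_add_one] at h1
          omega
        simp [this]
      · rw [ih t h, if_pos (by omega)]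
        have h1 := hf h
        have h2 := hf (Nat.le_succ M)
        simp only [Nat.succ_eq_add_one] at h2
        omega
  ext t
  rcases Nat.le_total t N with h | h
  · rw [key N t h, hN, Nat.sub_zero]
  · have h1 := gt_antitone (ofSeq f N) h
    have h2 := hf h
    have h3 := key N N le_rfl
    omega

/-! ### Counting partitions and transporting counts -/

open Classical in
/-- The number of partitions of `n` whose multiset of parts satisfies `P`. -/
noncomputable def cnt (n : ℕ) (P : Multiset ℕ → Prop) : ℤ :=
  ((univ.filter fun π : n.Partition => P π.parts).card : ℤ)

open Classical in
theorem cnt_eq_sum (n : ℕ) (P : Multiset ℕ → Prop) :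
    cnt n P = ∑ π : n.Partition, if P π.parts then 1 else 0 := by
  simp [cnt]

theorem cnt_congr {n : ℕ} {P Q : Multiset ℕ → Prop}
    (h : ∀ s : Multiset ℕ, (∀ a ∈ s, 0 < a) → s.sum = n → (P s ↔ Q s)) : cnt n P = cnt n Q := by
  classical
  rw [cnt_eq_sum, cnt_eq_sum]
  refine sum_congr rfl fun π _ => if_congr (h _ (fun a ha => π.parts_pos ha) π.parts_sum) rfl rfl

theorem cnt_eq_zero {n : ℕ} {P : Multiset ℕ → Prop}
    (h : ∀ s : Multiset ℕ, (∀ a ∈ s, 0 < a) → s.sum = n → ¬ P s) : cnt n P = 0 := by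
  classical
  rw [cnt_eq_sum]
  exact sum_eq_zero fun π _ => if_neg (h _ (fun a ha => π.parts_pos ha) π.parts_sum)

/-- Transport of a count along mutually inverse maps of multisets. -/
theorem cnt_eq_of_bij {n k : ℕ} {P Q : Multiset ℕ → Prop} (f g : Multiset ℕ → Multiset ℕ)
    (hf : ∀ s : Multiset ℕ, (∀ a ∈ s, 0 < a) → s.sum = n → P s →
      (∀ a ∈ f s, 0 < a) ∧ (f s).sum = k ∧ Q (f s) ∧ g (f s) = s)
    (hg : ∀ s : Multiset ℕ, (∀ a ∈ s, 0 < a) → s.sum = k → Q s →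
      (∀ a ∈ g s, 0 < a) ∧ (g s).sum = n ∧ P (g s) ∧ f (g s) = s) :
    cnt n P = cnt k Q := by
  classical
  unfold cnt
  norm_cast
  have hf' : ∀ π : n.Partition, P π.parts → _ := fun π h =>
    hf π.parts (fun a ha => π.parts_pos ha) π.parts_sum h
  have hg' : ∀ π : k.Partition, Q π.parts → _ := fun π h =>
    hg π.parts (fun a ha => π.parts_pos ha) π.parts_sum h
  refine card_bij'
    (fun π h => ⟨f π.parts, fun {a} ha => (hf' π (mem_filter.1 h).2).1 a ha,
      (hf' π (mem_filter.1 h).2).2.1⟩)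
    (fun π h => ⟨g π.parts, fun {a} ha => (hg' π (mem_filter.1 h).2).1 a ha,
      (hg' π (mem_filter.1 h).2).2.1⟩) ?_ ?_ ?_ ?_
  · exact fun π h => mem_filter.2 ⟨mem_univ _, (hf' π (mem_filter.1 h).2).2.2.1⟩
  · exact fun π h => mem_filter.2 ⟨mem_univ _, (hg' π (mem_filter.1 h).2).2.2.1⟩
  · exact fun π h => Nat.Partition.ext (hf' π (mem_filter.1 h).2).2.2.2
  · exact fun π h => Nat.Partition.ext (hg' π (mem_filter.1 h).2).2.2.2

/-- The number of partitions of `n - k` satisfying `P`, which is zero if `n < k`. -/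
noncomputable def sub (n k : ℕ) (P : Multiset ℕ → Prop) : ℤ := if k ≤ n then cnt (n - k) P else 0

theorem cnt_le_and (n : ℕ) {σ : Multiset ℕ} (hσ : ∀ a ∈ σ, 0 < a) (P : Multiset ℕ → Prop) :
    cnt n (fun s => σ ≤ s ∧ P (s - σ)) = sub n σ.sum P := by
  unfold sub
  split_ifs with h
  · refine cnt_eq_of_bij (fun s => s - σ) (fun s => s + σ) ?_ ?_
    · rintro s hs hsum ⟨hle, hP⟩
      have h1 : s - σ + σ = s := tsub_add_cancel_of_le hle
      refine ⟨fun a ha => hs a (Multiset.mem_of_le tsub_le_self ha), ?_, hP, h1⟩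
      have h2 := congrArg Multiset.sum h1
      rw [Multiset.sum_add] at h2
      omega
    · intro s hs hsum hP
      refine ⟨fun a ha => (Multiset.mem_add.1 ha).elim (hs a) (hσ a), ?_, ⟨?_, ?_⟩, ?_⟩
      · rw [Multiset.sum_add]; omega
      · exact Multiset.le_add_left _ _
      · rwa [add_tsub_cancel_right]
      · exact add_tsub_cancel_right _ _
  · refine cnt_eq_zero fun s hs hsum hP => h ?_
    rw [← hsum, ← tsub_add_cancel_of_le hP.1, Multiset.sum_add]
    omega

theorem cnt_mem_and (n : ℕ) {t : ℕ} (ht : 0 < t) (P : Multiset ℕ → Prop) :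
    cnt n (fun s => t ∈ s ∧ P (s.erase t)) = sub n t P := by
  have := cnt_le_and n (σ := {t}) (by simpa using ht) P
  simpa [Multiset.sub_singleton] using this

/-- Splitting off the `j` parts larger than `t` and diminishing each of them by one. -/
theorem cnt_gt_eq (N j t : ℕ) (P : (ℕ → ℕ) → Prop) :
    cnt (N + j) (fun s => gt s t = j ∧ P (fun i => if i < t then gt s i else gt s (i + 1))) =
      cnt N (fun s => gt s t ≤ j ∧ (0 < t → j ≤ gt s (t - 1)) ∧ P (gt s)) := by
  set D : (ℕ → ℕ) → ℕ → ℕ := fun f i => if i < t then f i else f (i + 1) with hD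
  set I : (ℕ → ℕ) → ℕ → ℕ := fun f i => if i < t then f i else if i = t then j else f (i - 1)
    with hI
  -- `D` deletes the entry at index `t` of the conjugate and `I` inserts `j` there; the inequalities
  -- on the right-hand side say exactly that the insertion keeps the sequence decreasing.
  have hDI : ∀ f, D (I f) = f := by
    intro f
    ext i
    simp only [hD, hI]
    split_ifs <;> first | rfl | omega
  have hID : ∀ f, f t = j → I (D f) = f := by
    intro f hf
    ext i
    simp only [hD, hI]
    rcases lt_trichotomy i t with h | h | h
    · simp [h]
    · simp [h, hf]
    · rw [if_neg (by omega), if_neg (by omega), if_neg (by omega)]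
      congr 1
      omega
  have hsumI : ∀ f M, t ≤ M → ∑ i ∈ range (M + 1), I f i = ∑ i ∈ range M, f i + j := by
    intro f M hM
    induction M, hM using Nat.le_induction with
    | base =>
      rw [sum_range_succ]
      congr 1
      · exact sum_congr rfl fun i hi => by simp [hI, mem_range.1 hi]
      · simp [hI]
    | succ M hM ih =>
      rw [sum_range_succ, ih, sum_range_succ]
      have : I f (M + 1) = f M := by
        simp only [hI]
        rw [if_neg (by omega), if_neg (by omega)]
        rfl
      omega
  have hDanti : ∀ f, Antitone f → Antitone (D f) := by
    intro f hf a b hab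
    simp only [hD]
    split_ifs <;> exact hf (by omega)
  have hIanti : ∀ f, Antitone f → f t ≤ j → (0 < t → j ≤ f (t - 1)) → Antitone (I f) := by
    intro f hf h1 h2 a b hab
    simp only [hI]
    by_cases c1 : b < t
    · rw [if_pos c1, if_pos (by omega)]
      exact hf hab
    by_cases c2 : b = t
    · rw [if_neg c1, if_pos c2]
      by_cases c3 : a < t
      · rw [if_pos c3]
        exact (h2 (by omega)).trans (hf (by omega))
      · rw [if_neg c3, if_pos (by omega)]
    · rw [if_neg c1, if_neg c2]
      by_cases c3 : a < t
      · rw [if_pos c3]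
        exact hf (by omega)
      by_cases c4 : a = t
      · rw [if_neg c3, if_pos c4]
        exact (hf (by omega)).trans h1
      · rw [if_neg c3, if_neg c4]
        exact hf (by omega)
  -- Large enough to lie beyond `t` and beyond every part on either side, so all the sequences
  -- involved have vanished.
  set M := N + j + t with hM
  refine cnt_eq_of_bij (fun s => ofSeq (D (gt s)) M) (fun s => ofSeq (I (gt s)) (M + 1)) ?_ ?_
  · rintro s hs hsum ⟨hj, hP⟩
    have hz : D (gt s) M = 0 := by
      simp only [hD]
      rw [if_neg (by omega)]
      exact gt_eq_zero_of_sum_le (by omega)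
    have hz1 : gt s (M + 1) = 0 := gt_eq_zero_of_sum_le (by omega)
    have hg := gt_ofSeq (hDanti _ (gt_antitone s)) hz
    refine ⟨fun a => pos_of_mem_ofSeq, ?_, ?_, ?_⟩
    · have h1 := hsumI (D (gt s)) M (by omega)
      rw [hID _ hj, ← sum_eq_sum_gt hz1] at h1
      rw [sum_eq_sum_gt (by rw [hg]; exact hz), hg]
      omega
    · rw [hg]
      refine ⟨?_, fun h0 => ?_, hP⟩
      · simp only [hD, lt_irrefl, if_false, ← hj]
        exact gt_antitone s (Nat.le_succ t)
      · simp only [hD]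
        rw [if_pos (by omega), ← hj]
        exact gt_antitone s (by omega)
    · rw [hg, hID _ hj]
      exact ext_gt (fun a => pos_of_mem_ofSeq) hs (gt_ofSeq (gt_antitone s) hz1)
  · rintro s hs hsum ⟨h1, h2, hP⟩
    have hz : I (gt s) (M + 1) = 0 := by
      simp only [hI]
      rw [if_neg (by omega), if_neg (by omega)]
      exact gt_eq_zero_of_sum_le (by omega)
    have hz1 : gt s M = 0 := gt_eq_zero_of_sum_le (by omega)
    have hg := gt_ofSeq (hIanti _ (gt_antitone s) h1 h2) hz
    refine ⟨fun a => pos_of_mem_ofSeq, ?_, ?_, ?_⟩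
    · rw [sum_eq_sum_gt (by rw [hg]; exact hz), hg, hsumI _ _ (by omega), ← sum_eq_sum_gt hz1, hsum]
    · rw [hg]
      refine ⟨by simp [hI], ?_⟩
      have h3 := hDI (gt s)
      simp only [hD] at h3
      rw [h3]
      exact hP
    · rw [hg, hDI]
      exact ext_gt (fun a => pos_of_mem_ofSeq) hs (gt_ofSeq (gt_antitone s) hz1)

theorem cnt_add_cnt_not (n : ℕ) (P : Multiset ℕ → Prop) :
    cnt n P + cnt n (fun s => ¬ P s) = cnt n fun _ => True := by
  classical
  simp only [cnt_eq_sum, ← sum_add_distrib]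
  refine sum_congr rfl fun π _ => ?_
  split_ifs <;> rfl

theorem cnt_fiber {n : ℕ} {P : Multiset ℕ → Prop} (g : Multiset ℕ → ℕ) (k r : ℕ)
    (h : ∀ s : Multiset ℕ, (∀ a ∈ s, 0 < a) → s.sum = n → P s → r ≤ g s ∧ g s < k + r) :
    cnt n P = ∑ i ∈ range k, cnt n fun s => g s = i + r ∧ P s := by
  classical
  simp only [cnt_eq_sum]
  rw [sum_comm]
  refine sum_congr rfl fun π _ => ?_
  by_cases hP : P π.parts
  · obtain ⟨h1, h2⟩ := h _ (fun a ha => π.parts_pos ha) π.parts_sum hP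
    rw [if_pos hP, sum_eq_single (g π.parts - r)]
    · rw [if_pos ⟨by omega, hP⟩]
    · exact fun i _ hi => if_neg fun h3 => hi (by omega)
    · exact fun hi => absurd (mem_range.2 (by omega)) hi
  · simp [hP]

/-! ### The recursion for `pBar` -/

theorem mex_of_notMem {A a n : ℕ} {π : n.Partition} (h : a ∉ π.parts) : mex A a π = a :=
  le_antisymm (Nat.sInf_le ⟨le_rfl, Nat.ModEq.refl _, h⟩)
    (le_csInf ⟨a, le_rfl, Nat.ModEq.refl _, h⟩ fun _ hm => hm.1)

/-- The minimal excludant of a multiset. -/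
noncomputable def multisetMex (A a : ℕ) (s : Multiset ℕ) : ℕ :=
  sInf {m : ℕ | a ≤ m ∧ m ≡ a [MOD A] ∧ m ∉ s}

theorem multisetMex_of_mem {A a : ℕ} (hA : 0 < A) {s : Multiset ℕ} (h : a ∈ s) :
    multisetMex A a s = multisetMex A (a + A) (s.erase a) := by
  unfold multisetMex
  congr 1
  ext m
  simp only [Set.mem_ofPred_eq]
  constructor
  · rintro ⟨h1, h2, h3⟩
    have hne : m ≠ a := fun hm => h3 (hm ▸ h)
    refine ⟨?_, h2.trans (by simp [Nat.ModEq]), fun h4 => h3 (Multiset.mem_of_mem_erase h4)⟩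
    have h4 := (Nat.modEq_iff_dvd' h1).1 h2.symm
    have := Nat.le_of_dvd (by omega) h4
    omega
  · rintro ⟨h1, h2, h3⟩
    refine ⟨by omega, h2.trans (by simp [Nat.ModEq]), fun h4 => h3 ?_⟩
    exact (Multiset.mem_erase_of_ne (by omega)).2 h4

theorem pBar_eq_cnt (A a n : ℕ) :
    (pBar A a n : ℤ) = cnt n fun s => multisetMex A a s ≡ A + a [MOD 2 * A] := by
  classical
  unfold pBar cnt
  congr 2
  ext π
  simp only [mem_filter, mem_univ, true_and]
  rfl

theorem not_modEq_iff {A a m : ℕ} (hA : 0 < A) (h : m ≡ a [MOD A]) :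
    ¬ m ≡ a [MOD 2 * A] ↔ m ≡ A + a [MOD 2 * A] := by
  have h1 : (A : ℤ) ∣ a - m := Nat.modEq_iff_dvd.1 h
  obtain ⟨c, hc⟩ := h1
  have hA' : (A : ℤ) ≠ 0 := by exact_mod_cast hA.ne'
  rw [Nat.modEq_iff_dvd, Nat.modEq_iff_dvd]
  push_cast
  rw [hc, show (A : ℤ) + a - m = A * (c + 1) by rw [mul_add, ← hc]; ring, mul_comm 2 (A : ℤ),
    mul_dvd_mul_iff_left hA', mul_dvd_mul_iff_left hA']
  omega

/-- If `a` is not a part, the mex is `a`, which lies in the wrong class modulo `2 * A`. Otherwise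
one copy of `a` can be removed, and the search for the mex starts at `a + A`. -/
theorem cnt_mex_eq {A a : ℕ} (hA : 0 < A) (ha : 0 < a) (n : ℕ) :
    (pBar A a n : ℤ) = sub n a fun s => multisetMex A (a + A) s ≡ A + a [MOD 2 * A] := by
  rw [pBar_eq_cnt, ← cnt_mem_and n ha]
  refine cnt_congr fun s hs hsum => ?_
  by_cases h : a ∈ s
  · rw [multisetMex_of_mem hA h]
    simp [h]
  · simp only [h, false_and, iff_false]
    have : multisetMex A a s = a :=
      mex_of_notMem (π := (⟨s, fun {a} => hs a, hsum⟩ : n.Partition)) h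
    rw [this, ← not_modEq_iff hA (Nat.ModEq.refl a)]
    exact not_not.2 (Nat.ModEq.refl a)

theorem pBar_eq_zero {A a n : ℕ} (hA : 0 < A) (h : n < a) : (pBar A a n : ℤ) = 0 := by
  rw [cnt_mex_eq hA (by omega), sub, if_neg (by omega)]

/-- The mex starting at `a + A` is congruent to `a` modulo `A`, so it lies in exactly one of two
classes modulo `2 * A`: one is counted by the first term after removal of `a`, the other by the
second. -/
theorem pBar_add_pBar {A a : ℕ} (hA : 0 < A) (ha : 0 < a) (n : ℕ) :
    (pBar A a (n + a) : ℤ) + pBar A (a + A) n = cnt n fun _ => True := by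
  rw [cnt_mex_eq hA ha, sub, if_pos (by omega), Nat.add_sub_cancel, pBar_eq_cnt,
    ← cnt_add_cnt_not n fun s => multisetMex A (a + A) s ≡ A + a [MOD 2 * A]]
  congr 1
  refine cnt_congr fun s hs hsum => ?_
  have := (mex_spec hA (a + A) (⟨s, fun {a} => hs a, hsum⟩ : n.Partition)).2.1
  have h1 : multisetMex A (a + A) s ≡ A + a [MOD A] := by rw [add_comm A]; exact this
  rw [not_modEq_iff hA h1, add_comm a A]

/-- The recursion that determines `pBar`. -/
theorem eq_pBar_of_recursion {A b : ℕ} (hA : 0 < A) (hb : 0 < b) {F : ℕ → ℕ → ℤ}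
    (h0 : ∀ a n, b ≤ a → n < a → F a n = 0)
    (h1 : ∀ a n, b ≤ a → F a (n + a) + F (a + A) n = cnt n fun _ => True) (a n : ℕ)
    (hba : b ≤ a) : F a n = pBar A a n := by
  induction n using Nat.strong_induction_on generalizing a with
  | _ n ih =>
    rcases Nat.lt_or_ge n a with h | h
    · rw [h0 a n hba h, pBar_eq_zero hA h]
    · obtain ⟨k, rfl⟩ := Nat.exists_eq_add_of_le' h
      have h2 := h1 a k hba
      have h3 := pBar_add_pBar hA (lt_of_lt_of_le hb hba) k
      rw [ih k (by omega) (a + A) (by omega)] at h2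
      omega

/-! ### Tails of the rank -/

theorem sup_le_iff_gt {s : Multiset ℕ} {a : ℕ} : s.sup ≤ a ↔ gt s a = 0 := by
  rw [gt_eq_zero_iff, Multiset.sup_le]

theorem sup_le_sum (s : Multiset ℕ) : s.sup ≤ s.sum :=
  sup_le_iff_gt.2 (gt_eq_zero_of_sum_le le_rfl)

theorem gt_eq_gt_erase {s : Multiset ℕ} {t : ℕ} (h : t ∈ s) (i : ℕ) :
    gt s i = gt (s.erase t) i + if i < t then 1 else 0 := by
  rw [← gt_cons, Multiset.cons_erase h]

theorem mem_iff_gt_lt {s : Multiset ℕ} {t : ℕ} (ht : 0 < t) : t ∈ s ↔ gt s t < gt s (t - 1) := by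
  have := gt_eq_gt_succ_add_count s (t - 1)
  rw [Nat.sub_add_cancel ht] at this
  rw [← Multiset.count_pos]
  omega

theorem sup_eq_iff {s : Multiset ℕ} {t : ℕ} (ht : 0 < t) : s.sup = t ↔ t ∈ s ∧ gt s t = 0 := by
  rw [mem_iff_gt_lt ht, ← sup_le_iff_gt]
  have h1 := sup_le_iff_gt (s := s) (a := t)
  have h2 := sup_le_iff_gt (s := s) (a := t - 1)
  omega

/-- Removing the largest part. -/
theorem cnt_sup_eq (n t c : ℕ) :
    cnt n (fun s => s.sup = t ∧ gt s 0 ≤ c + 1) = sub n t fun s => gt s 0 ≤ c ∧ gt s t = 0 := by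
  rcases Nat.eq_zero_or_pos t with rfl | ht
  · rw [sub, if_pos (Nat.zero_le _), Nat.sub_zero]
    refine cnt_congr fun s _ _ => ?_
    have := sup_le_iff_gt (s := s) (a := 0)
    omega
  · rw [← cnt_mem_and n ht]
    refine cnt_congr fun s _ _ => ?_
    rw [sup_eq_iff ht, and_assoc]
    refine and_congr_right fun h => ?_
    have h1 := gt_eq_gt_erase h 0
    have h2 := gt_eq_gt_erase h t
    rw [if_pos ht] at h1
    rw [if_neg (lt_irrefl _)] at h2
    omega

/-- Diminishing every part by one. -/
theorem cnt_gt_zero_eq (n l a : ℕ) :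
    cnt n (fun s => gt s 0 = l ∧ s.sup ≤ a + 1) = sub n l fun s => gt s 0 ≤ l ∧ gt s a = 0 := by
  rw [sub]
  split_ifs with h
  · have := cnt_gt_eq (n - l) l 0 (fun f => f a = 0)
    rw [Nat.sub_add_cancel h] at this
    simpa only [sup_le_iff_gt, not_lt_zero, if_false, false_implies, true_and] using this
  · refine cnt_eq_zero fun s _ hsum hs => h ?_
    rw [← hs.1, ← hsum]
    exact gt_le_sum s 0

theorem sup_pos_iff {s : Multiset ℕ} : 0 < s.sup ↔ 0 < gt s 0 := by
  have := sup_le_iff_gt (s := s) (a := 0)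
  omega

theorem gt_zero_pos {s : Multiset ℕ} (hs : ∀ a ∈ s, 0 < a) (h : 0 < s.sum) : 0 < gt s 0 := by
  rw [← card_eq_gt_zero hs, Multiset.card_pos]
  rintro rfl
  simp at h

/-- Dyson's map. On the left, fix the largest part `i + a` and remove it; on the right, fix the
number of parts `i` and diminish each by one. Both leave the partitions of `n - i` with at most `i`
parts, all at most `i + a`. -/
theorem cnt_rank_upper (n : ℕ) {a : ℕ} (ha : 0 < a) :
    cnt (n + a) (fun s => gt s 0 + a ≤ s.sup + 1) =
      cnt n fun s => ¬ gt s 0 + (a + 3) ≤ s.sup + 1 := by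
  rw [cnt_fiber (fun s => s.sup) (n + 1) a, cnt_fiber (fun s => gt s 0) (n + 1) 0]
  · refine sum_congr rfl fun i _ => ?_
    have h1 := cnt_sup_eq (n + a) (i + a) i
    have h2 := cnt_gt_zero_eq n i (i + a)
    have h3 : sub (n + a) (i + a) (fun s => gt s 0 ≤ i ∧ gt s (i + a) = 0) =
        sub n i (fun s => gt s 0 ≤ i ∧ gt s (i + a) = 0) := by
      simp [sub, Nat.add_sub_add_right]
    rw [← h1, ← h2] at h3
    refine Eq.trans ?_ (h3.trans ?_) <;> exact cnt_congr fun s _ _ => by omega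
  · intro s hs hsum _
    have := gt_le_sum s 0
    omega
  · intro s hs hsum h
    have := sup_le_sum s
    have := gt_zero_pos hs (by omega)
    omega

/-- The conjugate argument: on the left the first column, of length `i + a`, is removed, on the
right the largest part `i`. -/
theorem cnt_rank_lower (n : ℕ) {a : ℕ} (ha : 0 < a) :
    cnt (n + a) (fun s => s.sup + a ≤ gt s 0 + 1) =
      cnt n fun s => ¬ s.sup + (a + 3) ≤ gt s 0 + 1 := by
  rw [cnt_fiber (fun s => gt s 0) (n + 1) a, cnt_fiber (fun s => s.sup) (n + 1) 0]
  · refine sum_congr rfl fun i _ => ?_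
    have h1 := cnt_sup_eq n i (i + a)
    have h2 := cnt_gt_zero_eq (n + a) (i + a) i
    have h3 : sub (n + a) (i + a) (fun s => gt s 0 ≤ i + a ∧ gt s i = 0) =
        sub n i (fun s => gt s 0 ≤ i + a ∧ gt s i = 0) := by
      simp [sub, Nat.add_sub_add_right]
    rw [← h1, ← h2] at h3
    refine Eq.trans ?_ (h3.trans ?_) <;> exact cnt_congr fun s _ _ => by omega
  · intro s hs hsum _
    have := sup_le_sum s
    omega
  · intro s hs hsum h
    have := gt_le_sum s 0
    have := sup_pos_iff.2 (gt_zero_pos hs (by omega))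
    omega

theorem cnt_rank_ge (a n : ℕ) (ha : 2 ≤ a) :
    cnt n (fun s => gt s 0 + a ≤ s.sup + 1) = pBar 3 a n := by
  refine eq_pBar_of_recursion (b := 2) (F := fun a n => cnt n (fun s => gt s 0 + a ≤ s.sup + 1))
    (by norm_num) (by norm_num) (fun a n ha hn => ?_) (fun a n ha => ?_) a n ha
  · refine cnt_eq_zero fun s hs hsum h => ?_
    have := sup_le_sum s
    have := sup_pos_iff (s := s)
    omega
  · rw [cnt_rank_upper n (by omega), add_comm, cnt_add_cnt_not]

theorem cnt_rank_le (a n : ℕ) (ha : 2 ≤ a) :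
    cnt n (fun s => s.sup + a ≤ gt s 0 + 1) = pBar 3 a n := by
  refine eq_pBar_of_recursion (b := 2) (F := fun a n => cnt n (fun s => s.sup + a ≤ gt s 0 + 1))
    (by norm_num) (by norm_num) (fun a n ha hn => ?_) (fun a n ha => ?_) a n ha
  · refine cnt_eq_zero fun s hs hsum h => ?_
    have := gt_le_sum s 0
    have := sup_pos_iff (s := s)
    omega
  · rw [cnt_rank_lower n (by omega), add_comm, cnt_add_cnt_not]

/-! ### Splitting counts, and the conjugation symmetry -/

theorem cnt_and_add_cnt_and_not (n : ℕ) (P Q : Multiset ℕ → Prop) :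
    cnt n (fun s => P s ∧ Q s) + cnt n (fun s => P s ∧ ¬ Q s) = cnt n P := by
  classical
  simp only [cnt_eq_sum, ← sum_add_distrib]
  refine sum_congr rfl fun π _ => ?_
  by_cases h1 : P π.parts <;> by_cases h2 : Q π.parts <;> simp [h1, h2]

theorem sub_eq_of_imp {n k : ℕ} {P Q : Multiset ℕ → Prop} (h : ∀ s, Q s → P s) :
    sub n k P - sub n k Q = sub n k fun s => P s ∧ ¬ Q s := by
  unfold sub
  split_ifs with hk
  · rw [← cnt_and_add_cnt_and_not _ P Q, cnt_congr (P := fun s => P s ∧ Q s) (Q := Q)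
      fun s _ _ => and_iff_right_of_imp (h s)]
    ring
  · simp

theorem sub_congr {n k : ℕ} {P Q : Multiset ℕ → Prop} (h : ∀ s, P s ↔ Q s) :
    sub n k P = sub n k Q := by
  rw [funext fun s => propext (h s)]

theorem cnt_gt_zero_eq_sub (n l : ℕ) :
    cnt n (fun s => gt s 0 = l) = sub n l fun s => gt s 0 ≤ l := by
  rw [sub]
  split_ifs with h
  · have := cnt_gt_eq (n - l) l 0 (fun _ => True)
    rw [Nat.sub_add_cancel h] at this
    simpa using this
  · refine cnt_eq_zero fun s _ hsum hs => h ?_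
    rw [← hs, ← hsum]
    exact gt_le_sum s 0

theorem cnt_sup_eq_sub (n t : ℕ) :
    cnt n (fun s => s.sup = t) = sub n t fun s => s.sup ≤ t := by
  have h := cnt_sup_eq n t n
  rw [cnt_congr (Q := fun s => s.sup = t)] at h
  · rw [h, sub, sub]
    split_ifs with h1
    · refine cnt_congr fun s _ hsum => ?_
      have := gt_le_sum s 0
      have := sup_le_iff_gt (s := s) (a := t)
      omega
    · rfl
  · intro s _ hsum
    have := gt_le_sum s 0
    omega

/-- As many partitions have at most `b` parts as have largest part at most `b`. -/
theorem cnt_gt_zero_le_eq_cnt_sup_le (n b : ℕ) :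
    cnt n (fun s => gt s 0 ≤ b) = cnt n fun s => s.sup ≤ b := by
  induction n using Nat.strong_induction_on generalizing b with
  | _ n ih =>
    induction b with
    | zero =>
      refine cnt_congr fun s _ _ => ?_
      have := sup_le_iff_gt (s := s) (a := 0)
      omega
    | succ b ihb =>
      rw [← cnt_and_add_cnt_and_not n (fun s => gt s 0 ≤ b + 1) (fun s => gt s 0 ≤ b),
        ← cnt_and_add_cnt_and_not n (fun s => s.sup ≤ b + 1) (fun s => s.sup ≤ b)]
      congr 1
      · refine Eq.trans ?_ (ihb.trans ?_) <;> exact cnt_congr fun s _ _ => by omega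
      -- In the layer where the bound `b + 1` is attained, removing the first column or the largest
      -- part reduces to a smaller `n`.
      · rw [cnt_congr (Q := fun s => gt s 0 = b + 1) fun s _ _ => by omega,
          cnt_congr (P := fun s => s.sup ≤ b + 1 ∧ _) (Q := fun s => s.sup = b + 1)
            fun s _ _ => by omega, cnt_gt_zero_eq_sub, cnt_sup_eq_sub, sub, sub]
        split_ifs with h
        · exact ih _ (by omega) _
        · rfl

theorem cnt_le_gt_zero_eq_cnt_le_sup (n m : ℕ) :
    cnt n (fun s => m ≤ gt s 0) = cnt n fun s => m ≤ s.sup := by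
  rcases m with _ | m
  · simp
  · have h1 := cnt_add_cnt_not n fun s => gt s 0 ≤ m
    have h2 := cnt_add_cnt_not n fun s => s.sup ≤ m
    simp only [not_le, cnt_gt_zero_le_eq_cnt_sup_le] at h1 h2
    simp only [Nat.succ_le_iff]
    omega

/-! ### Decreasing sequences against a diagonal -/

/-- The inequalities allow `j` to be inserted at index `i + 1` of the conjugate. -/
theorem sub_gt_eq_cnt_gt {n i j : ℕ} (h : i < n) :
    sub n (i + 1) (fun s => gt s (i + 1) ≤ j ∧ j ≤ gt s i) =
      cnt (n - (i + 1) + j) fun s => gt s (i + 1) = j := by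
  have := cnt_gt_eq (n - (i + 1)) j (i + 1) (fun _ => True)
  rw [sub, if_pos (by omega)]
  simpa using this.symm

/-- Adding a part `i + 1` raises `gt s i` by one and fixes `gt s (i + 1)`, which makes the second
inequality strict; that strictness in turn forces `i + 1` to be a part. -/
theorem sub_gt_eq_cnt (n i j : ℕ) :
    sub n (i + 1) (fun s => gt s (i + 1) ≤ j ∧ j ≤ gt s i) =
      cnt n fun s => gt s (i + 1) ≤ j ∧ j < gt s i := by
  rw [← cnt_mem_and n (show 0 < i + 1 from Nat.succ_pos i)]
  refine cnt_congr fun s _ _ => ?_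
  by_cases h : i + 1 ∈ s
  · have h1 := gt_eq_gt_erase h i
    have h2 := gt_eq_gt_erase h (i + 1)
    rw [if_pos (by omega)] at h1
    rw [if_neg (by omega)] at h2
    simp only [h, true_and]
    omega
  · have h1 := mem_iff_gt_lt (s := s) (show 0 < i + 1 from Nat.succ_pos i)
    rw [h1, Nat.add_sub_cancel] at h
    simp only [h1, Nat.add_sub_cancel, h, false_and, false_iff]
    omega

/-- A decreasing sequence meets or jumps over the sequence `t + m` exactly once. -/
theorem sum_meet_add_jump {f : ℕ → ℕ} (hf : Antitone f) (m T : ℕ) :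
    ∑ t ∈ range T, (if f t = t + m then (1 : ℤ) else 0) +
      ∑ t ∈ range T, (if f (t + 1) ≤ t + m ∧ t + m < f t then (1 : ℤ) else 0) =
      (if m ≤ f 0 then 1 else 0) - if T + m ≤ f T then 1 else 0 := by
  induction T with
  | zero => simp
  | succ T ih =>
    rw [sum_range_succ, sum_range_succ, add_add_add_comm, ih]
    have := hf (Nat.le_succ T)
    simp only [Nat.succ_eq_add_one] at this
    -- The condition `t + m ≤ f t` fails for good once it fails; at the step where it is lost, `f`
    -- meets the diagonal or jumps over it.
    split_ifs <;> omega

/-- A sum that counts partitions with crank at most `-m`. -/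
noncomputable def lowerSum (m n : ℕ) : ℤ :=
  ∑ i ∈ range n, sub n (i + 1) fun s => gt s (i + 1) + m ≤ i + 1 ∧ i + 1 ≤ gt s i + m

theorem lowerSum_eq_zero {m n : ℕ} (h : n < m) : lowerSum m n = 0 := by
  refine sum_eq_zero fun i hi => ?_
  rw [mem_range] at hi
  rw [sub, if_pos (by omega)]
  exact cnt_eq_zero fun s _ _ => by omega

/-- Inserting the conjugate entry `k = i + 1 - m` makes the size `n` for every `i`: these are the
meetings with the diagonal. -/
theorem lowerSum_add {m : ℕ} (hm : 0 < m) (n : ℕ) :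
    lowerSum m (n + m) = ∑ k ∈ range (n + 1), cnt n fun s => gt s (k + m) = k := by
  obtain ⟨m, rfl⟩ := Nat.exists_eq_succ_of_ne_zero hm.ne'
  rw [lowerSum, show range (n + m.succ) = range (m + (n + 1)) by congr 1; omega,
    sum_range_add, sum_eq_zero, zero_add]
  · refine sum_congr rfl fun k hk => ?_
    rw [mem_range] at hk
    have := sub_gt_eq_cnt_gt (n := n + m.succ) (i := m + k) (j := k) (by omega)
    rw [show n + m.succ - (m + k + 1) + k = n by omega] at this
    rw [show k + m.succ = m + k + 1 by omega, ← this]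
    exact sub_congr fun s => by omega
  · intro i hi
    rw [mem_range] at hi
    rw [sub, if_pos (by omega)]
    exact cnt_eq_zero fun s _ _ => by omega

/-- Inserting the part `i + 1` instead, with `k = i - m`, gives the jumps over the same diagonal. -/
theorem lowerSum_succ (m n : ℕ) :
    lowerSum (m + 1) n =
      ∑ k ∈ range (n + 1), cnt n fun s => gt s (k + 1 + m) ≤ k ∧ k < gt s (k + m) := by
  have h1 : ∀ i, sub n (i + 1) (fun s => gt s (i + 1) + (m + 1) ≤ i + 1 ∧
      i + 1 ≤ gt s i + (m + 1)) = cnt n fun s => m ≤ i ∧ gt s (i + 1) ≤ i - m ∧ i - m < gt s i := by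
    intro i
    rcases Nat.lt_or_ge i m with h | h
    · rw [cnt_eq_zero fun s _ _ => by omega, sub]
      split_ifs
      · exact cnt_eq_zero fun s _ _ => by omega
      · rfl
    · simp only [h, true_and]
      rw [← sub_gt_eq_cnt]
      exact sub_congr fun s => by omega
  have h2 : ∑ i ∈ range (m + (n + 1)),
      cnt n (fun s => m ≤ i ∧ gt s (i + 1) ≤ i - m ∧ i - m < gt s i) = lowerSum (m + 1) n := by
    rw [show m + (n + 1) = n + (m + 1) by omega, sum_range_add, lowerSum, sum_congr rfl
      fun i _ => h1 i, sum_eq_zero (s := range (m + 1)), add_zero]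
    intro i _
    refine cnt_eq_zero fun s _ hsum => ?_
    have := gt_eq_zero_of_sum_le (s := s) (t := n + i) (by omega)
    omega
  rw [← h2, sum_range_add, sum_eq_zero (s := range m), zero_add]
  · refine sum_congr rfl fun k _ => cnt_congr fun s _ _ => ?_
    rw [show m + k + 1 = k + 1 + m by omega, show m + k = k + m by omega]
    omega
  · intro i hi
    rw [mem_range] at hi
    exact cnt_eq_zero fun s _ _ => by omega

theorem lowerSum_eq_pBar (m n : ℕ) (hm : 0 < m) : lowerSum m n = pBar 1 m n := by
  refine eq_pBar_of_recursion (b := 1) (F := lowerSum)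
    (by norm_num) (by norm_num) (fun a n ha hn => lowerSum_eq_zero hn) (fun a n ha => ?_) m n hm
  rw [lowerSum_add ha, lowerSum_succ]
  simp only [cnt_eq_sum]
  rw [sum_comm, sum_comm (s := range (n + 1)), ← sum_add_distrib]
  refine sum_congr rfl fun π _ => ?_
  have h := sum_meet_add_jump (f := fun t => gt π.parts (t + a))
    (fun x y hxy => gt_antitone _ (by omega)) 0 (n + 1)
  have h0 : gt π.parts (n + 1 + a) = 0 :=
    gt_eq_zero_of_sum_le (by rw [π.parts_sum]; omega)
  simp only [add_zero, h0] at h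
  rw [if_pos (Nat.zero_le _), if_neg (by omega), sub_zero] at h
  rw [if_pos trivial]
  convert h

/-- The number of partitions with at least `m` parts exceeds that of crank at least `m` by this. -/
noncomputable def upperSum (m n : ℕ) : ℤ :=
  ∑ i ∈ range n, sub n (i + 1) fun s => gt s (i + 1) ≤ i + m ∧ i + m ≤ gt s i

theorem upperSum_succ (m n : ℕ) :
    upperSum (m + 1) n = ∑ i ∈ range n, cnt (n + m) fun s => gt s (i + 1) = i + 1 + m := by
  refine sum_congr rfl fun i hi => ?_
  rw [mem_range] at hi
  rw [sub_gt_eq_cnt_gt hi, show n - (i + 1) + (i + (m + 1)) = n + m by omega]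
  exact cnt_congr fun s _ _ => by omega

theorem upperSum_eq (m n : ℕ) :
    upperSum m n = ∑ i ∈ range n, cnt n fun s => gt s (i + 1) ≤ i + m ∧ i + m < gt s i :=
  sum_congr rfl fun i _ => sub_gt_eq_cnt n i (i + m)

/-- For partitions of `n + m` against the diagonal `t + m`, the first sum counts jumps, the second
meetings with `t ≥ 1`, and the third term meetings at `t = 0`. One of these occurs, and only once,
precisely if the sequence starts on or above the diagonal. -/
theorem upperSum_add_upperSum (m n : ℕ) :
    upperSum m (n + m) + upperSum (m + 1) n + cnt (n + m) (fun s => gt s 0 = m) =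
      cnt (n + m) fun s => m ≤ gt s 0 := by
  rw [upperSum_succ, upperSum_eq]
  simp only [cnt_eq_sum]
  rw [sum_comm, sum_comm (s := range n), ← sum_add_distrib, ← sum_add_distrib]
  refine sum_congr rfl fun π _ => ?_
  have h := sum_meet_add_jump (gt_antitone π.parts) m (n + 1 + m)
  have h0 : ∀ t, gt π.parts (n + m + t) = 0 := fun t =>
    gt_eq_zero_of_sum_le (by rw [π.parts_sum]; omega)
  have h1 : ∀ t, gt π.parts t ≤ n + m := fun t => (gt_le_sum _ t).trans π.parts_sum.le
  have h2 := h0 1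
  rw [show n + m + 1 = n + 1 + m by omega] at h2
  -- A meeting needs `t + m ≤ n + m`, so the terms with `t > n` vanish; then `t = 0` is split off.
  rw [sum_range_add _ (n + 1), sum_eq_zero (s := range m), add_zero, sum_range_succ'] at h
  · rw [show n + 1 + m = n + m + 1 by omega, sum_range_succ (n := n + m)] at h
    have h3 := h0 0
    rw [add_zero] at h3
    have h4 : gt π.parts (n + m + 1) = 0 := h0 1
    rw [h3, h4] at h
    simp only [zero_add] at h
    simp only [not_lt_zero, and_false, if_false, add_zero] at h
    rw [if_neg (show ¬ n + m + 1 + m ≤ 0 by omega)] at h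
    rw [sub_zero, add_comm, ← add_assoc] at h
    convert h
  · intro i _
    have := h1 (n + 1 + i)
    exact if_neg (by omega)

theorem cnt_sub_upperSum_eq_pBar (m n : ℕ) (hm : 0 < m) :
    cnt n (fun s => m ≤ gt s 0) - upperSum m n = pBar 1 m n := by
  refine eq_pBar_of_recursion (b := 1)
    (F := fun m n => cnt n (fun s => m ≤ gt s 0) - upperSum m n)
    (by norm_num) (by norm_num) (fun a n ha hn => ?_) (fun a n ha => ?_) m n hm
  · rw [upperSum_eq, sum_eq_zero, cnt_eq_zero, sub_zero]
    · intro s _ hsum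
      have := gt_le_sum s 0
      omega
    · intro i _
      refine cnt_eq_zero fun s _ hsum => ?_
      have := gt_le_sum s i
      omega
  · have h1 := upperSum_add_upperSum a n
    have h2 := cnt_gt_zero_eq_sub (n + a) a
    rw [sub, if_pos (by omega), Nat.add_sub_cancel] at h2
    have h3 := cnt_add_cnt_not n fun s => gt s 0 ≤ a
    simp only [not_le] at h3
    simp only [Nat.succ_le_iff]
    linarith

/-! ### Tails of the crank, by the number of ones -/

theorem cnt_le_count_one (n k : ℕ) {w : ℕ} (hw : 0 < w) (Q : ℕ → Prop) :
    cnt n (fun s => k ≤ s.count 1 ∧ Q (gt s w)) = sub n k fun s => Q (gt s w) := by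
  have h := cnt_le_and n (σ := Multiset.replicate k 1)
    (fun a ha => by rw [Multiset.eq_of_mem_replicate ha]; norm_num) (fun s => Q (gt s w))
  rw [Multiset.sum_replicate, smul_eq_mul, mul_one] at h
  rw [← h]
  refine cnt_congr fun s _ _ => ?_
  rw [Multiset.le_count_iff_replicate_le]
  refine and_congr_right fun hle => ?_
  have h1 := gt_add (s - Multiset.replicate k 1) (Multiset.replicate k 1) w
  rw [tsub_add_cancel_of_le hle, gt_replicate, if_neg (by omega), add_zero] at h1
  rw [h1]

theorem cnt_count_one_eq (n : ℕ) {w : ℕ} (hw : 0 < w) (Q : ℕ → Prop) :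
    cnt n (fun s => s.count 1 = w ∧ Q (gt s w)) =
      sub n w (fun s => Q (gt s w)) - sub n (w + 1) fun s => Q (gt s w) := by
  rw [← cnt_le_count_one n w hw, ← cnt_le_count_one n (w + 1) hw,
    ← cnt_and_add_cnt_and_not n (fun s => w ≤ s.count 1 ∧ Q (gt s w)) (fun s => w < s.count 1),
    cnt_congr (P := fun s => (w ≤ s.count 1 ∧ Q (gt s w)) ∧ w < s.count 1)
      (Q := fun s => w + 1 ≤ s.count 1 ∧ Q (gt s w)) fun s _ _ => ?_, add_sub_cancel_left]
  · refine cnt_congr fun s _ _ => ?_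
    rw [and_right_comm]
    exact and_congr_left fun _ => by omega
  · rw [and_right_comm]
    exact and_congr_left fun _ => by omega

/-- Having exactly `w` ones is having at least `w` but not at least `w + 1`, and stripping ones
leaves `gt s w` unchanged for `w > 0`. Regrouping the differences by the number of stripped ones
pairs `Q (i + 1)` with `Q i`, with a boundary term at `0`. -/
theorem cnt_one_mem_eq_sum (n : ℕ) (Q : ℕ → ℕ → Prop) :
    cnt n (fun s => 0 < s.count 1 ∧ Q (s.count 1) (gt s (s.count 1))) =
      ∑ i ∈ range n, (sub n (i + 1) (fun s => Q (i + 1) (gt s (i + 1))) -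
        sub n (i + 1) fun s => Q i (gt s i)) + sub n 1 fun s => Q 0 (gt s 0) := by
  rw [cnt_fiber (fun s => s.count 1) n 1]
  · rw [sum_congr rfl fun i _ => (cnt_congr (Q := fun s => s.count 1 = i + 1 ∧
      Q (i + 1) (gt s (i + 1))) fun s _ _ => ?_).trans (cnt_count_one_eq n i.succ_pos (Q (i + 1)))]
    · rw [sum_sub_distrib, sum_sub_distrib]
      have h := (sum_range_succ' (fun i => sub n (i + 1) fun s => Q i (gt s i)) n).symm.trans
        (sum_range_succ _ n)
      rw [show sub n (n + 1) (fun s => Q n (gt s n)) = 0 from if_neg (by omega)] at h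
      simp only [Nat.succ_eq_add_one] at h ⊢
      linarith
    · constructor
      · rintro ⟨h1, -, h3⟩
        exact ⟨h1, h1 ▸ h3⟩
      · rintro ⟨h1, h3⟩
        exact ⟨h1, by omega, h1.symm ▸ h3⟩
  · intro s _ hsum h
    have h1 : s.count 1 ≤ s.sum := by
      have := gt_eq_gt_succ_add_count s 0
      have := gt_le_sum s 0
      rw [zero_add] at *
      omega
    omega

theorem cnt_crank_le (m n : ℕ) (hm : 0 < m) :
    cnt n (fun s => 0 < s.count 1 ∧ gt s (s.count 1) + m ≤ s.count 1) = pBar 1 m n := by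
  rw [← lowerSum_eq_pBar m n hm, cnt_one_mem_eq_sum n fun w g => g + m ≤ w,
    sub_congr (k := 1) (Q := fun _ => False) fun s => ⟨fun h => by omega, False.elim⟩]
  have : sub n 1 (fun _ => False) = 0 := by
    simp [sub, cnt]
  rw [this, add_zero]
  refine sum_congr rfl fun i _ => ?_
  rw [sub_eq_of_imp]
  · exact sub_congr fun s => by omega
  · intro s h
    have := gt_antitone s (Nat.le_succ i)
    simp only [Nat.succ_eq_add_one] at this
    omega

theorem cnt_crank_ge (m n : ℕ) (hm : 0 < m) (hn : 2 ≤ n) :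
    cnt n (fun s => s.count 1 = 0 ∧ m ≤ s.sup ∨
      0 < s.count 1 ∧ s.count 1 + m ≤ gt s (s.count 1)) = pBar 1 m n := by
  rw [← cnt_sub_upperSum_eq_pBar m n hm, ← cnt_and_add_cnt_and_not n _ fun s => s.count 1 = 0]
  -- The boundary term `sub n 1` complements the partitions without ones: after conjugation it
  -- counts those with a one and largest part at least `m`.
  have h1 : cnt n (fun s => s.count 1 = 0 ∧ m ≤ s.sup) + sub n 1 (fun s => m ≤ gt s 0) =
      cnt n fun s => m ≤ gt s 0 := by
    have h2 : sub n 1 (fun s => m ≤ gt s 0) = sub n 1 fun s => m ≤ s.sup := by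
      unfold sub
      rw [cnt_le_gt_zero_eq_cnt_le_sup]
    rw [h2, ← cnt_mem_and n one_pos, cnt_le_gt_zero_eq_cnt_le_sup,
      ← cnt_and_add_cnt_and_not n (fun s => m ≤ s.sup) (fun s => s.count 1 = 0)]
    congr 1
    · exact cnt_congr fun s _ _ => and_comm
    · refine cnt_congr fun s hs hsum => ?_
      rw [Multiset.count_eq_zero, not_not, and_comm]
      refine and_congr_left fun h => ?_
      have h3 := gt_eq_gt_erase h (m - 1)
      have h4 := sup_le_iff_gt (s := s) (a := m - 1)
      have h5 := sup_le_iff_gt (s := s.erase 1) (a := m - 1)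
      rcases Nat.lt_or_ge 1 m with h6 | h6
      · rw [if_neg (by omega)] at h3
        omega
      -- Only here is `2 ≤ n` needed: removing a one must leave a nonempty partition.
      · obtain rfl : m = 1 := by omega
        have h7 := gt_zero_pos (s := s.erase 1) (fun a ha => hs a (Multiset.mem_of_mem_erase ha))
          (by have := Multiset.sum_erase h; omega)
        rw [Nat.sub_self] at *
        omega
  have h3 := cnt_one_mem_eq_sum n fun w g => w + m ≤ g
  simp only [zero_add] at h3
  rw [cnt_congr (Q := fun s => s.count 1 = 0 ∧ m ≤ s.sup) fun s _ _ => by omega,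
    cnt_congr (P := fun s => _ ∧ ¬ s.count 1 = 0)
      (Q := fun s => 0 < s.count 1 ∧ s.count 1 + m ≤ gt s (s.count 1)) fun s _ _ => by omega,
    h3, ← h1]
  have h4 : upperSum m n = - ∑ i ∈ range n, (sub n (i + 1) (fun s => i + 1 + m ≤ gt s (i + 1)) -
      sub n (i + 1) fun s => i + m ≤ gt s i) := by
    rw [← sum_neg_distrib]
    refine sum_congr rfl fun i _ => ?_
    rw [neg_sub, sub_eq_of_imp]
    · exact sub_congr fun s => by omega
    · intro s h
      have := gt_antitone s (Nat.le_succ i)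
      simp only [Nat.succ_eq_add_one] at this
      omega
  rw [h4]
  ring

/-! ### Second moments from tails -/

/-- For `r < |k|` exactly one indicator is `1`, and for larger `r` none, so this is the sum of the
first `|k|` odd numbers. -/
theorem sq_eq_sum_tails (k : ℤ) {n : ℕ} (hk : |k| ≤ n) :
    k ^ 2 = ∑ r ∈ range n, (2 * (r : ℤ) + 1) *
      ((if (r : ℤ) + 1 ≤ k then 1 else 0) + if k + (r + 1) ≤ 0 then 1 else 0) := by
  have key : ∀ n : ℕ, ∑ r ∈ range n, (2 * (r : ℤ) + 1) *
      ((if (r : ℤ) + 1 ≤ k then 1 else 0) + if k + (r + 1) ≤ 0 then 1 else 0) =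
      min |k| n ^ 2 := by
    intro n
    induction n with
    | zero => simp
    | succ n ih =>
      rw [sum_range_succ, ih]
      rcases le_or_gt |k| n with h | h
      · have h1 := abs_le.1 h
        rw [min_eq_left h, min_eq_left (by push_cast; omega), if_neg (by omega), if_neg (by omega)]
        ring
      · rw [min_eq_right h.le, min_eq_right (by push_cast; omega)]
        rcases lt_abs.1 h with h1 | h1
        · rw [if_pos (by omega), if_neg (by omega)]
          push_cast
          ring
        · rw [if_neg (by omega), if_pos (by omega)]
          push_cast
          ring
  rw [key, min_eq_left hk, sq_abs]

theorem finsum_sq_mul_card {α : Type*} [Fintype α] (c : α → ℤ) :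
    ∑ᶠ m : ℤ, m ^ 2 * ((univ.filter fun x => c x = m).card : ℤ) = ∑ x, c x ^ 2 := by
  rw [finsum_eq_sum_of_support_subset (s := univ.image c)]
  · rw [← sum_fiberwise_of_maps_to (g := c) (t := univ.image c)
      fun x _ => mem_image_of_mem c (mem_univ x)]
    refine sum_congr rfl fun m _ => ?_
    rw [sum_congr rfl (g := fun _ => m ^ 2) fun x hx => by rw [(mem_filter.1 hx).2], sum_const,
      nsmul_eq_mul, mul_comm]
  · intro m hm
    by_contra h
    refine hm ?_
    beta_reduce
    rw [filter_eq_empty_iff.2, card_empty]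
    · simp
    · rintro x - rfl
      exact h (by simp)

/-- A second moment in terms of the upper and lower tails of the distribution. -/
theorem finsum_sq_mul_card_partition {n : ℕ} (c : n.Partition → ℤ) (U V : ℕ → Multiset ℕ → Prop)
    (p : ℕ → ℤ) (hc : ∀ π, |c π| ≤ n)
    (hU : ∀ (r : ℕ) (π : n.Partition), (r : ℤ) + 1 ≤ c π ↔ U r π.parts)
    (hV : ∀ (r : ℕ) (π : n.Partition), c π + (r + 1) ≤ 0 ↔ V r π.parts)
    (hpU : ∀ r, cnt n (U r) = p r) (hpV : ∀ r, cnt n (V r) = p r) :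
    ∑ᶠ m : ℤ, m ^ 2 * ((univ.filter fun π => c π = m).card : ℤ) =
      2 * ∑ r ∈ range n, (2 * (r : ℤ) + 1) * p r := by
  classical
  rw [finsum_sq_mul_card, sum_congr rfl fun π _ => sq_eq_sum_tails (c π) (hc π), sum_comm, mul_sum]
  refine sum_congr rfl fun r _ => ?_
  rw [← mul_sum, sum_add_distrib]
  simp only [hU, hV]
  have h1 := hpU r
  have h2 := hpV r
  rw [cnt_eq_sum] at h1 h2
  have h3 : ∑ π : n.Partition, (if U r π.parts then (1 : ℤ) else 0) = p r := by convert h1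
  have h4 : ∑ π : n.Partition, (if V r π.parts then (1 : ℤ) else 0) = p r := by convert h2
  rw [h3, h4]
  ring

theorem rankMoment_two (n : ℕ) :
    rankMoment 2 n = 2 * ∑ r ∈ range (n - 1), (2 * (r : ℤ) + 1) * (pBar 3 (r + 2) n : ℤ) := by
  have h : rankMoment 2 n = 2 * ∑ r ∈ range n, (2 * (r : ℤ) + 1) * (pBar 3 (r + 2) n : ℤ) := by
    have hrank : ∀ π : n.Partition, rank π = (π.parts.sup : ℤ) - gt π.parts 0 := fun π => by
      rw [rank, largestPart, card_eq_gt_zero fun a ha => π.parts_pos ha]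
    refine finsum_sq_mul_card_partition (fun π : n.Partition => rank π)
      (fun r s => gt s 0 + (r + 2) ≤ s.sup + 1) (fun r s => s.sup + (r + 2) ≤ gt s 0 + 1) _
      (fun π => ?_) (fun r π => ?_) (fun r π => ?_) (fun r => cnt_rank_ge (r + 2) n (by omega))
      (fun r => cnt_rank_le (r + 2) n (by omega))
    · have h1 := sup_le_sum π.parts
      have h2 := gt_le_sum π.parts 0
      rw [π.parts_sum] at h1 h2
      rw [hrank, abs_le]
      omega
    · rw [hrank]
      omega
    · rw [hrank]
      omega
  rw [h]
  rcases n with _ | n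
  · rfl
  -- The last term drops out, because its mex starts above the size of the partition.
  · rw [sum_range_succ, pBar_eq_zero (by norm_num) (by omega), Nat.add_sub_cancel, mul_zero,
      add_zero]

theorem crankMoment_two_of_ne_one {n : ℕ} (hn : n ≠ 1) :
    crankMoment 2 n = 2 * ∑ r ∈ range n, (2 * (r : ℤ) + 1) * (pBar 1 (r + 1) n : ℤ) := by
  have hfilter : ∀ π : n.Partition,
      (π.parts.filter fun i => π.parts.count 1 < i).card = gt π.parts (π.parts.count 1) :=
    fun π => (Multiset.countP_eq_card_filter _ _).symm
  simp only [crankMoment, crankNumber, if_neg hn]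
  have hcount : ∀ π : n.Partition, π.parts.count 1 ≤ n := fun π => by
    have h1 := gt_eq_gt_succ_add_count π.parts 0
    have h2 := gt_le_sum π.parts 0
    rw [π.parts_sum] at h2
    rw [zero_add] at h1
    omega
  rcases Nat.eq_zero_or_pos n with rfl | hn0
  · rw [finsum_sq_mul_card]
    refine sum_eq_zero fun π _ => ?_
    have h1 := hcount π
    have h2 := sup_le_sum π.parts
    rw [π.parts_sum] at h2
    rw [crank, if_pos (by omega), largestPart, Nat.le_zero.1 h2]
    rfl
  · refine finsum_sq_mul_card_partition (fun π : n.Partition => crank π)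
      (fun m s => s.count 1 = 0 ∧ m + 1 ≤ s.sup ∨
        0 < s.count 1 ∧ s.count 1 + (m + 1) ≤ gt s (s.count 1))
      (fun m s => 0 < s.count 1 ∧ gt s (s.count 1) + (m + 1) ≤ s.count 1) _
      (fun π => ?_) (fun r π => ?_) (fun r π => ?_)
      (fun r => cnt_crank_ge (r + 1) n (by omega) (by omega))
      (fun r => cnt_crank_le (r + 1) n (by omega))
    · have h1 := sup_le_sum π.parts
      have h2 := gt_le_sum π.parts (π.parts.count 1)
      have h3 := hcount π
      rw [π.parts_sum] at h1 h2
      rw [crank, hfilter, largestPart, abs_le]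
      split_ifs <;> omega
    · rw [crank, hfilter, largestPart]
      split_ifs <;> omega
    · rw [crank, hfilter, largestPart]
      split_ifs <;> omega

theorem crankMoment_two_one : crankMoment 2 1 = 2 := by
  rw [crankMoment, finsum_eq_sum_of_support_subset (s := {1, -1})]
  · rw [sum_pair (by norm_num)]
    simp [crankNumber]
  · intro m hm
    by_contra h
    refine hm ?_
    simp only [coe_insert, coe_singleton, Set.mem_insert_iff, Set.mem_singleton_iff, not_or] at h
    by_cases h0 : m = 0 <;> simp [crankNumber, h, h0]

theorem pBar_one_one_one : (pBar 1 1 1 : ℤ) = 1 := by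
  have h := pBar_add_pBar (A := 1) (a := 1) one_pos one_pos 0
  rw [pBar_eq_zero (a := 1 + 1) one_pos (by norm_num), zero_add, add_zero] at h
  rw [h, cnt]
  simp

end MexPartition

theorem theorem3p8 (n : ℕ) :
    MexPartition.rankMoment 2 n =
        2 * ∑ r ∈ Finset.range (n - 1), (2 * (r : ℤ) + 1) * (MexPartition.pBar 3 (r + 2) n : ℤ) ∧
      MexPartition.crankMoment 2 n =
        2 * ∑ r ∈ Finset.range n, (2 * (r : ℤ) + 1) * (MexPartition.pBar 1 (r + 1) n : ℤ) := by
  refine ⟨MexPartition.rankMoment_two n, ?_⟩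
  -- For `n = 1` the conventional values of `M(m, 1)` replace the crank count.
  by_cases hn : n = 1
  · subst hn
    rw [MexPartition.crankMoment_two_one, Finset.sum_range_one, zero_add,
      MexPartition.pBar_one_one_one]
    norm_num
  · exact MexPartition.crankMoment_two_of_ne_one hn
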